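/- Let $(X_i)_{i\ge 1}$ be an i.i.d. sequence of random vectors on a probability space $(\Omega,\mathcal F,\mathbb P)$ with values in a set $\mathbb X\subset\mathbb R^d$ and with common law $\mathbb P_X$ (expectations below are over $X\sim \mathbb P_X$). Let $a<b$ be real numbers, and for $k\in[a,b]$ let $\mathcal H_k=\{h(\cdot;\beta):\mathbb X\to\mathbb R:\ \beta\in\mathbb T_k\}$ with $\mathbb T_k\subset\mathbb R^q$. Let $\ell:\mathbb R\to\mathbb R$ be a loss function and write $\ell(x;\beta)=\ell(h(x;\beta))$, $$R_n(\beta)=\frac1n\sum_{i=1}^n \ell(X_i;\beta),\qquad r(\beta)=\mathbb E\{\ell(X;\beta)\}.$$ Assume that $k\mapsto\mathbb T_k$ is a continuous (upper and lower hemicontinuous), compact-valued correspondence on $[a,b]$, and that the sets are nested: $\mathbb T_k\subset\mathbb T_l$ whenever $k\le l$. Assume that for each $k\in[a,b]$: * (A1) $\ell(x;\cdot)$ is continuous on $\mathbb T_k$ for each $x\in\mathbb X$, and $\ell(\cdot;\beta)$ is Borel measurable on $\mathbb X$ for each $\beta\in\mathbb T_k$. * (A2) $\mathbb T_k$ is compact,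 and there is some $\tau_k\in\mathbb T_k$ with $\mathbb E\{\ell(X;\tau_k)^2\}<\infty$. * (A3) There is a measurable $\mathcal G_k:\mathbb X\to\mathbb R_{\ge0}$ with $\mathbb E\{\mathcal G_k(X)^2\}<\infty$ such that, for all $\beta,\tau\in\mathbb T_k$, $|\ell(x;\beta)-\ell(x;\tau)|\le\mathcal G_k(x)\|\beta-\tau\|$ for $\mathbb P_X$-almost every $x\in\mathbb X$. For $k\in[a,b]$ and $n\ge1$ let $P_{k,n}$ be real-valued random variables on $\Omega$ such that, for each $n\ge1$, almost surely $k\mapsto P_{k,n}$ is continuous and strictly increasing on $[a,b]$, and such that: * (B1) for each $k\in[a,b]$, $P_{k,n}>0$ almost surely for every $n\ge1$, and $P_{k,n}\to0$ in probability as $n\to\infty$. * (B2) for all $k<l$ in $[a,b]$, $\sqrt n\,(P_{l,n}-P_{k,n})\to\infty$ in probability as $n\to\infty$. Define $$\mathcal K=\operatorname*{arg\,min}_{k\in[a,b]}\Big\{\min_{\beta\in\mathbb T_k}r(\beta)\Big\},\qquad k^*=\min\mathcal K,\qquad \hat K_n=\min\operatorname*{arg\,min}_{k\in[a,b]}\Big\{\min_{\beta\in\mathbb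 T_k}R_n(\beta)+P_{k,n}\Big\}.$$ Then all these minima exist (for $\hat K_n$, almost surely for each $n\ge1$), and $\hat K_n$ converges in probability to $k^*$: for every $\sigma>0$, $\mathbb P(|\hat K_n-k^*|\ge\sigma)\to0$ as $n\to\infty$. -/

import Mathlib

open MeasureTheory ProbabilityTheory Filter Topology

noncomputable section

namespace PanIC

/-- The loss `ℓ(x; β) = ℓ(h(x; β))` of the hypothesis `h(· ; β)` at the data point `x`. -/
def loss {𝒳 E : Type*} (ℓ : ℝ → ℝ) (h : 𝒳 → E → ℝ) (x : 𝒳) (β : E) : ℝ := ℓ (h x β)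

/-- Expected risk `r(β) = 𝔼[L(X; β)]`, where `PX` is the law of the data point `X`. -/
def expectedRisk {𝒳 E : Type*} [MeasurableSpace 𝒳] (PX : Measure 𝒳) (L : 𝒳 → E → ℝ)
    (β : E) : ℝ :=
  ∫ x, L x β ∂PX

/-- Empirical risk `Rₙ(β) = (1/n) ∑ L(Xᵢ; β)` of the first `n` data points `X 0, …, X (n-1)`. -/
def empiricalRisk {𝒳 E Ω : Type*} (L : 𝒳 → E → ℝ) (X : ℕ → Ω → 𝒳) (n : ℕ) (ω : Ω)
    (β : E) : ℝ :=
  (1 / (n : ℝ)) * ∑ i ∈ Finset.range n, L (X i ω) β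

/-- The minimum of `f` over `S` (as an infimum; the theorem asserts that it is attained). -/
def minOver {E : Type*} (f : E → ℝ) (S : Set E) : ℝ := sInf (f '' S)

/-- The set of minimisers of `f` over `S`. -/
def argminOver (f : ℝ → ℝ) (S : Set ℝ) : Set ℝ := {k | k ∈ S ∧ IsMinOn f S k}

/-- The set of indices in `[a, b]` which minimise `k ↦ min_{β ∈ T k} r(β)`. -/
def optimalIndices {E : Type*} (a b : ℝ) (T : ℝ → Set E) (r : E → ℝ) : Set ℝ :=
  argminOver (fun k => minOver r (T k)) (Set.Icc a b)

/-- The smallest optimal index `k*` (as an infimum; the theorem asserts that it is attained). -/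
def optimalIndex {E : Type*} (a b : ℝ) (T : ℝ → Set E) (r : E → ℝ) : ℝ :=
  sInf (optimalIndices a b T r)

/-- The set of indices in `[a, b]` which minimise `k ↦ min_{β ∈ T k} Rₙ(β) + P_{k,n}`. -/
def selectedIndices {𝒳 E Ω : Type*} (a b : ℝ) (T : ℝ → Set E) (L : 𝒳 → E → ℝ)
    (X : ℕ → Ω → 𝒳) (P : ℝ → ℕ → Ω → ℝ) (n : ℕ) (ω : Ω) : Set ℝ :=
  argminOver (fun k => minOver (empiricalRisk L X n ω) (T k) + P k n ω) (Set.Icc a b)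

/-- The PanIC estimator: the smallest minimiser of the penalised empirical risk
(as an infimum; the theorem asserts that it is attained almost surely). -/
def estimator {𝒳 E Ω : Type*} (a b : ℝ) (T : ℝ → Set E) (L : 𝒳 → E → ℝ)
    (X : ℕ → Ω → 𝒳) (P : ℝ → ℕ → Ω → ℝ) (n : ℕ) (ω : Ω) : ℝ :=
  sInf (selectedIndices a b T L X P n ω)

/-- Convergence in probability to `+∞`. -/
def TendstoInProbAtTop {Ω : Type*} [MeasurableSpace Ω] (μ : Measure Ω) (Z : ℕ → Ω → ℝ) : Prop :=
  ∀ M : ℝ, Tendsto (fun n => μ {ω | Z n ω ≤ M}) atTop (𝓝 0)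

/-- A1: the loss is a Carathéodory function on `𝒳 × S`. -/
def CondA1 {𝒳 E : Type*} [MeasurableSpace 𝒳] [TopologicalSpace E] (L : 𝒳 → E → ℝ)
    (S : Set E) : Prop :=
  (∀ x, ContinuousOn (L x) S) ∧ ∀ β ∈ S, Measurable fun x => L x β

/-- A2: `S` is compact and the loss is square integrable at some parameter of `S`. -/
def CondA2 {𝒳 E : Type*} [MeasurableSpace 𝒳] [TopologicalSpace E] (PX : Measure 𝒳)
    (L : 𝒳 → E → ℝ) (S : Set E) : Prop :=
  IsCompact S ∧ ∃ τ ∈ S, Integrable (fun x => L x τ ^ 2) PX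

/-- A3: the loss is Lipschitz on `S`, with a square integrable Lipschitz constant. -/
def CondA3 {𝒳 E : Type*} [MeasurableSpace 𝒳] [NormedAddCommGroup E] (PX : Measure 𝒳)
    (L : 𝒳 → E → ℝ) (S : Set E) : Prop :=
  ∃ G : 𝒳 → ℝ, Measurable G ∧ (∀ x, 0 ≤ G x) ∧ Integrable (fun x => G x ^ 2) PX ∧
    ∀ β ∈ S, ∀ τ ∈ S, ∀ᵐ x ∂PX, |L x β - L x τ| ≤ G x * ‖β - τ‖

/-- B1, for one index: the penalty `Pk n`, `n ≥ 1`, is positive and tends to `0` in probability. -/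
def CondB1 {Ω : Type*} [MeasurableSpace Ω] (μ : Measure Ω) (Pk : ℕ → Ω → ℝ) : Prop :=
  (∀ n, 0 < n → ∀ᵐ ω ∂μ, 0 < Pk n ω) ∧ TendstoInMeasure μ Pk atTop fun _ => 0

/-- B2: `√n (P_{l,n} - P_{k,n}) → ∞` in probability for all indices `k < l` in `[a, b]`. -/
def CondB2 {Ω : Type*} [MeasurableSpace Ω] (μ : Measure Ω) (a b : ℝ)
    (P : ℝ → ℕ → Ω → ℝ) : Prop :=
  ∀ k ∈ Set.Icc a b, ∀ l ∈ Set.Icc a b, k < l →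
    TendstoInProbAtTop μ fun n ω => Real.sqrt n * (P l n ω - P k n ω)

end PanIC

end

/-! Let `m k` be the minimal risk over `T k`, `κ` the least optimal index, and `β₀` a minimiser of
the risk over `T κ`. Increments of the empirical risk from `β₀` differ from those of the risk by
O(n^{-1/2}) in probability, uniformly on `T b` (`exists_measure_deviation_le`). Comparing the
selected index K with `κ` then bounds m(K) - m(κ) + P_K - P_κ by M/√n outside an event of
probability at most C/M. If K ≥ κ + σ, then m(K) ≥ m(κ) and monotonicity of the penalty force √n
(P_{κ+σ} - P_κ) ≤ M, which B2 makes improbable. If K ≤ κ - σ, nestedness gives m(K) - m(κ) ≥ m(κ-σ)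
- m(κ) > 0, while `P κ n` and M/√n can be made small. The uniform rate comes from symmetrization and
chaining over dyadic nets (`rademacher_chaining`, `exists_lintegral_iSup_deviation_le`). The minima
over indices exist because the minimum over `T k` is lower semicontinuous in `k`. -/

namespace PanIC

/-! ### Metric entropy of bounded sets. -/

/-- Bounded sets of a Euclidean space have finite nets of exponentially decreasing radius whose
cardinality grows at most exponentially. -/
theorem exists_nets {q : ℕ} {D : Set (EuclideanSpace ℝ (Fin q))} (hD : Bornology.IsBounded D)
    {β₀ : EuclideanSpace ℝ (Fin q)} (h₀ : β₀ ∈ D) :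
    ∃ K : ℝ, 0 < K ∧ ∃ N : ℕ → Finset (EuclideanSpace ℝ (Fin q)), N 0 = {β₀} ∧
      (∀ j, ∀ β ∈ N j, β ∈ D) ∧ (∀ j, ∀ β ∈ D, ∃ τ ∈ N j, dist β τ ≤ K / 2 ^ j) ∧
      ∀ j, ((N j).card : ℝ) ≤ Real.exp (K * (j + 1)) := by
  classical
  obtain ⟨R', hR'⟩ := hD.exists_norm_le
  obtain ⟨R, hR⟩ := exists_nat_ge R'
  have hRD : ∀ β ∈ D, ‖β‖ ≤ R := fun β hβ => (hR' β hβ).trans hR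
  let c : ℕ → EuclideanSpace ℝ (Fin q) → Fin q → ℤ := fun j x i => ⌊(2 : ℝ) ^ j * x i⌋
  let I : ℕ → Finset (Fin q → ℤ) := fun j =>
    Fintype.piFinset fun _ => Finset.Icc (-(2 ^ j * R : ℤ)) (2 ^ j * R)
  have hcI : ∀ j, ∀ β ∈ D, c j β ∈ I j := by
    intro j β hβ
    simp only [I, c, Fintype.mem_piFinset, Finset.mem_Icc]
    intro i
    have h1 : |β i| ≤ R := by
      have := PiLp.norm_apply_le β i
      rw [Real.norm_eq_abs] at this
      exact this.trans (hRD β hβ)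
    rw [abs_le] at h1
    have h2 : (0 : ℝ) < 2 ^ j := by positivity
    constructor
    · rw [Int.le_floor]; push_cast; nlinarith
    · have : (⌊(2 : ℝ) ^ j * β i⌋ : ℝ) ≤ 2 ^ j * R :=
        (Int.floor_le _).trans (by nlinarith)
      exact_mod_cast this
  -- One representative in `D` per occupied dyadic cell: net points must lie in `D`, where the
  -- Lipschitz bounds hold. Empty cells receive the dummy `β₀`.
  let f : ℕ → (Fin q → ℤ) → EuclideanSpace ℝ (Fin q) := fun j z =>
    if h : ∃ β ∈ D, c j β = z then h.choose else β₀
  have hfD : ∀ j z, f j z ∈ D := by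
    intro j z
    simp only [f]
    split_ifs with h
    · exact h.choose_spec.1
    · exact h₀
  have hfc : ∀ j, ∀ β ∈ D, c j (f j (c j β)) = c j β := by
    intro j β hβ
    have h : ∃ τ ∈ D, c j τ = c j β := ⟨β, hβ, rfl⟩
    simp only [f, dif_pos h]
    exact h.choose_spec.2
  -- One constant for three bounds: the diameter 2R at level 0, the cell size q/2^j, and the entropy
  -- q(j + 2R).
  let K : ℝ := 2 * R + q * (2 * R + 1) + 1
  have hK : 0 < K := by positivity
  -- Level 0 is the single point `β₀`, so that every chain starts there.
  refine ⟨K, hK, fun j => if j = 0 then {β₀} else (I j).image (f j), by simp, ?_, ?_, ?_⟩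
  · intro j β hβ
    by_cases hj : j = 0
    · simp only [hj, if_true, Finset.mem_singleton] at hβ
      rwa [hβ]
    · simp only [hj, if_false, Finset.mem_image] at hβ
      obtain ⟨z, -, rfl⟩ := hβ
      exact hfD j z
  · intro j β hβ
    by_cases hj : j = 0
    · refine ⟨β₀, by simp [hj], ?_⟩
      subst hj
      rw [pow_zero, div_one, dist_eq_norm]
      have h1 := norm_sub_le β β₀
      have h2 := hRD β hβ
      have h3 := hRD β₀ h₀
      have : (0 : ℝ) ≤ q * (2 * R + 1) := by positivity
      simp only [K]
      linarith
    · refine ⟨f j (c j β), ?_, ?_⟩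
      · simp only [hj, if_false]
        exact Finset.mem_image_of_mem _ (hcI j β hβ)
      · have hcoord : ∀ i, dist (β i) (f j (c j β) i) ≤ 1 / 2 ^ j := by
          intro i
          have h1 : ⌊(2 : ℝ) ^ j * β i⌋ = ⌊(2 : ℝ) ^ j * f j (c j β) i⌋ :=
            (congrFun (hfc j β hβ) i).symm
          have h2 := Int.abs_sub_lt_one_of_floor_eq_floor h1
          have hp : (0 : ℝ) < 2 ^ j := by positivity
          rw [← mul_sub, abs_mul, abs_of_pos hp] at h2
          rw [Real.dist_eq, le_div_iff₀ hp]
          linarith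
        have h1 : dist β (f j (c j β)) ≤ ∑ i : Fin q, dist (β i) (f j (c j β) i) := by
          rw [EuclideanSpace.dist_eq]
          apply Real.sqrt_le_iff.mpr
          refine ⟨Finset.sum_nonneg fun _ _ => dist_nonneg, ?_⟩
          exact Finset.sum_sq_le_sq_sum_of_nonneg fun _ _ => dist_nonneg
        refine h1.trans ((Finset.sum_le_sum fun i _ => hcoord i).trans ?_)
        rw [Finset.sum_const, Finset.card_univ, Fintype.card_fin, nsmul_eq_mul, mul_one_div]
        apply div_le_div_of_nonneg_right _ (by positivity)
        have : (0 : ℝ) ≤ q * (2 * R) := by positivity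
        have : (0 : ℝ) ≤ R := by positivity
        simp only [K]
        linarith
  · intro j
    by_cases hj : j = 0
    · simp only [hj, if_true, Finset.card_singleton, Nat.cast_one]
      exact Real.one_le_exp (by positivity)
    · simp only [hj, if_false]
      have h1 : (((I j).image (f j)).card : ℝ) ≤ ((2 * (2 ^ j * R) + 1 : ℕ) : ℝ) ^ q := by
        have h2 := Finset.card_image_le (s := I j) (f := f j)
        have h3 : (I j).card = (2 * (2 ^ j * R) + 1) ^ q := by
          simp only [I, Fintype.card_piFinset, Int.card_Icc, Finset.prod_const, Finset.card_univ,
            Fintype.card_fin]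
          congr 1
          have e0 : (2 ^ j * R : ℤ) = ((2 ^ j * R : ℕ) : ℤ) := by push_cast; rfl
          rw [e0]
          omega
        rw [h3] at h2
        exact_mod_cast h2
      have h2 : ((2 * (2 ^ j * R) + 1 : ℕ) : ℝ) ≤ Real.exp (j + 2 * R) := by
        have e1 : (2 : ℝ) ^ j ≤ Real.exp j := by
          rw [← Real.exp_one_pow]
          exact pow_le_pow_left₀ (by norm_num) (by linarith [Real.add_one_le_exp (1 : ℝ)]) _
        have e2 : (2 : ℝ) * R + 1 ≤ Real.exp (2 * R) := Real.add_one_le_exp _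
        have e3 : (1 : ℝ) ≤ 2 ^ j := one_le_pow₀ (by norm_num)
        rw [Real.exp_add]
        push_cast
        calc (2 * (2 ^ j * R) + 1 : ℝ) ≤ 2 ^ j * (2 * R + 1) := by nlinarith
          _ ≤ _ := by gcongr
      refine h1.trans ((pow_le_pow_left₀ (by positivity) h2 q).trans ?_)
      rw [← Real.exp_nat_mul]
      apply Real.exp_le_exp.mpr
      have hq : (0 : ℝ) ≤ q := by positivity
      have hj' : (0 : ℝ) ≤ j := by positivity
      have hR0 : (0 : ℝ) ≤ R := by positivity
      have h4 : (0 : ℝ) ≤ q * R * j := by positivity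
      have h5 : (0 : ℝ) ≤ R * j := by positivity
      simp only [K]
      nlinarith

/-! ### Exponential moments of Rademacher sums. -/

/-- The value `±1` of a Rademacher sign. -/
def signVal (b : Bool) : ℝ := if b then 1 else -1

theorem abs_signVal (b : Bool) : |signVal b| = 1 := by
  cases b <;> simp [signVal]

/-- The sum over sign vectors factors into coordinates, each contributing 2 cosh(a i) ≤ 2 exp(a i ^
2 / 2). -/
theorem sum_exp_signs_le {n : ℕ} (a : Fin n → ℝ) :
    ∑ ε : Fin n → Bool, Real.exp (∑ i, signVal (ε i) * a i) ≤
      2 ^ n * Real.exp ((∑ i, a i ^ 2) / 2) := by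
  have h1 : ∑ ε : Fin n → Bool, Real.exp (∑ i, signVal (ε i) * a i)
      = ∏ i, ∑ b : Bool, Real.exp (signVal b * a i) := by
    rw [Finset.prod_univ_sum]
    simp only [Real.exp_sum, Fintype.piFinset_univ]
  have h2 : ∀ i, ∑ b : Bool, Real.exp (signVal b * a i) ≤ 2 * Real.exp (a i ^ 2 / 2) := by
    intro i
    have := Real.cosh_le_exp_half_sq (a i)
    rw [Real.cosh_eq] at this
    simp only [Fintype.sum_bool, signVal]
    simp
    linarith
  rw [h1]
  refine (Finset.prod_le_prod (fun i _ => by positivity) fun i _ => h2 i).trans_eq ?_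
  rw [Finset.prod_mul_distrib, ← Real.exp_sum, Finset.sum_div]
  simp

theorem sum_exp_abs_signs_le {n : ℕ} (a : Fin n → ℝ) {s : ℝ} (hs : 0 < s)
    (ha : ∑ i, a i ^ 2 ≤ s ^ 2) :
    ∑ ε : Fin n → Bool, Real.exp (|∑ i, signVal (ε i) * a i| / s) ≤ 2 ^ n * 4 := by
  have key : ∀ t : ℝ, t ^ 2 * s ^ 2 = 1 →
      ∑ ε : Fin n → Bool, Real.exp (∑ i, signVal (ε i) * (t * a i)) ≤ 2 ^ n * 2 := by
    intro t ht
    refine (sum_exp_signs_le _).trans ?_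
    gcongr
    have h1 : ∑ i, (t * a i) ^ 2 ≤ 1 := by
      simp only [mul_pow, ← Finset.mul_sum]
      rw [← ht]
      gcongr
    have h2 : Real.exp ((∑ i, (t * a i) ^ 2) / 2) ≤ Real.exp (1 / 2) := by gcongr
    have h3 : Real.exp (1 / 2) ^ 2 ≤ 2 ^ 2 := by
      rw [← Real.exp_nat_mul]
      norm_num
      linarith [Real.exp_one_lt_d9]
    exact h2.trans (le_of_sq_le_sq h3 (by norm_num))
  have h1 := key (1 / s) (by field_simp)
  have h2 := key (-(1 / s)) (by field_simp)
  have h3 : ∀ z : ℝ, Real.exp (|z| / s) ≤ Real.exp (1 / s * z) + Real.exp (-(1 / s) * z) := by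
    intro z
    rcases abs_cases z with ⟨h, -⟩ | ⟨h, -⟩
    · rw [h]
      have : z / s = 1 / s * z := by ring
      rw [this]
      linarith [Real.exp_pos (-(1 / s) * z)]
    · rw [h]
      have : -z / s = -(1 / s) * z := by ring
      rw [this]
      linarith [Real.exp_pos ((1 / s) * z)]
  have h4 : ∀ (t : ℝ) (ε : Fin n → Bool),
      ∑ i, signVal (ε i) * (t * a i) = t * ∑ i, signVal (ε i) * a i := by
    intro t ε
    rw [Finset.mul_sum]
    exact Finset.sum_congr rfl fun i _ => by ring
  simp only [h4] at h1 h2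
  calc _ ≤ ∑ ε : Fin n → Bool, (Real.exp (1 / s * ∑ i, signVal (ε i) * a i) +
        Real.exp (-(1 / s) * ∑ i, signVal (ε i) * a i)) := Finset.sum_le_sum fun ε _ => h3 _
    _ ≤ _ := by rw [Finset.sum_add_distrib]; linarith

/-- Used to bound a finite maximum: replacing the exponential by its sum over the candidates gives a
common bound, and taking `u` at least the logarithm of their number keeps the mean of that sum
bounded. -/
theorem le_mul_add_exp (z u : ℝ) {s : ℝ} (hs : 0 < s) : z ≤ s * (u + Real.exp (z / s - u)) := by
  have h1 := Real.add_one_le_exp (z / s - u)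
  have h2 : z = s * (z / s) := by field_simp
  nlinarith

theorem sum_succ_div_two_pow_le (J : ℕ) : ∑ j ∈ Finset.range J, ((j : ℝ) + 1) / 2 ^ j ≤ 4 := by
  have : ∑ j ∈ Finset.range J, ((j : ℝ) + 1) / 2 ^ j = 4 - (2 * J + 4) / 2 ^ J := by
    induction J with
    | zero => norm_num
    | succ J ih =>
      rw [Finset.sum_range_succ, ih]
      push_cast
      field_simp
      ring
  rw [this]
  have : (0 : ℝ) ≤ (2 * J + 4) / 2 ^ J := by positivity
  linarith

end PanIC

namespace PanIC

/-! ### Chaining. -/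

/-- Each point is joined to `β₀` through nets of radius K/2^j. Links at scale j have size of order
s/2^j and log-cardinality of order j + 1, so their maxima are summable. The constant depends on `D`
alone, not on `n`, `a` or `g`. -/
theorem rademacher_chaining {q : ℕ} {D : Set (EuclideanSpace ℝ (Fin q))}
    (hD : Bornology.IsBounded D) {β₀ : EuclideanSpace ℝ (Fin q)} (h₀ : β₀ ∈ D) :
    ∃ C : ℝ, 0 ≤ C ∧ ∀ (n : ℕ) (a : EuclideanSpace ℝ (Fin q) → Fin n → ℝ) (g : Fin n → ℝ) (s : ℝ),
      0 < s → (∀ i, 0 ≤ g i) → (∀ β ∈ D, ∀ τ ∈ D, ∀ i, |a β i - a τ i| ≤ g i * dist β τ) →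
      ∑ i, g i ^ 2 ≤ s ^ 2 →
      ∃ B : (Fin n → Bool) → ℝ,
        (∀ ε, ∀ β ∈ D, |∑ i, signVal (ε i) * (a β i - a β₀ i)| ≤ B ε) ∧
        ∑ ε, B ε ≤ 2 ^ n * (C * s) := by
  classical
  obtain ⟨K, hK, N, hN0, hND, hNnear, hNcard⟩ := exists_nets hD h₀
  -- The factor 4 bounds the series of (j + 1)/2^j; the final 1 pays for the truncated end of the
  -- chain.
  refine ⟨2 * K * (3 * K + 4) * 4 + 1, by positivity, ?_⟩
  intro n a g s hs hg hlip hgs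
  -- the increment process
  let Z : (Fin n → Bool) → EuclideanSpace ℝ (Fin q) × EuclideanSpace ℝ (Fin q) → ℝ :=
    fun ε p => ∑ i, signVal (ε i) * (a p.1 i - a p.2 i)
  let r : ℕ → ℝ := fun j => s * (2 * K / 2 ^ j)
  -- Logarithmic bound for the number of links: K(j + 2) + K(j + 1) ≤ 3K(j + 1).
  let u : ℕ → ℝ := fun j => 3 * K * (j + 1)
  have hr : ∀ j, 0 < r j := fun j => by positivity
  let Q : ℕ → Finset (EuclideanSpace ℝ (Fin q) × EuclideanSpace ℝ (Fin q)) := fun j =>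
    (N (j + 1) ×ˢ N j).filter fun p => dist p.1 p.2 ≤ 2 * K / 2 ^ j
  have hQD : ∀ j, ∀ p ∈ Q j, p.1 ∈ D ∧ p.2 ∈ D ∧ dist p.1 p.2 ≤ 2 * K / 2 ^ j := by
    intro j p hp
    simp only [Q, Finset.mem_filter, Finset.mem_product] at hp
    exact ⟨hND _ _ hp.1.1, hND _ _ hp.1.2, hp.2⟩
  have hQcard : ∀ j, ((Q j).card : ℝ) ≤ Real.exp (u j) := by
    intro j
    have h1 : ((Q j).card : ℝ) ≤ (N (j + 1)).card * (N j).card := by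
      have := Finset.card_filter_le (N (j + 1) ×ˢ N j) fun p => dist p.1 p.2 ≤ 2 * K / 2 ^ j
      rw [Finset.card_product] at this
      rw [← Nat.cast_mul]
      exact Nat.cast_le.mpr this
    refine h1.trans ((mul_le_mul (hNcard _) (hNcard _) (by positivity)
      (Real.exp_pos _).le).trans ?_)
    rw [← Real.exp_add]
    apply Real.exp_le_exp.mpr
    have : 0 ≤ K * j := by positivity
    simp only [u]
    push_cast
    nlinarith
  -- the exponential moments of the links
  have hexp : ∀ j, ∀ p ∈ Q j, ∑ ε, Real.exp (|Z ε p| / r j) ≤ 2 ^ n * 4 := by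
    intro j p hp
    obtain ⟨h1, h2, h3⟩ := hQD j p hp
    apply sum_exp_abs_signs_le _ (hr j)
    calc ∑ i, (a p.1 i - a p.2 i) ^ 2 ≤ ∑ i, g i ^ 2 * (2 * K / 2 ^ j) ^ 2 := by
          refine Finset.sum_le_sum fun i _ => ?_
          rw [← mul_pow]
          apply sq_le_sq'
          · have := (abs_le.mp ((hlip _ h1 _ h2 i).trans
              (mul_le_mul_of_nonneg_left h3 (hg i)))).1
            linarith
          · exact (abs_le.mp ((hlip _ h1 _ h2 i).trans
              (mul_le_mul_of_nonneg_left h3 (hg i)))).2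
      _ ≤ r j ^ 2 := by
          rw [← Finset.sum_mul]
          simp only [r]
          rw [mul_pow]
          gcongr
  -- Bounds all links at scale j at once; the shift by `u j` offsets the cardinality of `Q j` on
  -- averaging over signs.
  let b : ℕ → (Fin n → Bool) → ℝ := fun j ε =>
    r j * (u j + ∑ p ∈ Q j, Real.exp (|Z ε p| / r j - u j))
  have hb : ∀ j ε, ∀ p ∈ Q j, |Z ε p| ≤ b j ε := by
    intro j ε p hp
    refine (le_mul_add_exp _ (u j) (hr j)).trans ?_
    have := Finset.single_le_sum (f := fun p => Real.exp (|Z ε p| / r j - u j))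
      (fun p _ => (Real.exp_pos _).le) hp
    have hrj := hr j
    simp only [b]
    gcongr
  have hbsum : ∀ j, ∑ ε, b j ε ≤ 2 ^ n * (s * (2 * K * (3 * K + 4)) * ((j + 1) / 2 ^ j)) := by
    intro j
    have h1 : ∑ ε, ∑ p ∈ Q j, Real.exp (|Z ε p| / r j - u j) ≤ 2 ^ n * 4 := by
      rw [Finset.sum_comm]
      calc ∑ p ∈ Q j, ∑ ε, Real.exp (|Z ε p| / r j - u j)
          ≤ ∑ p ∈ Q j, 2 ^ n * 4 * Real.exp (-u j) := by
            refine Finset.sum_le_sum fun p hp => ?_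
            simp only [sub_eq_add_neg, Real.exp_add]
            rw [← Finset.sum_mul]
            exact mul_le_mul_of_nonneg_right (hexp j p hp) (Real.exp_pos _).le
        _ = (Q j).card * (2 ^ n * 4 * Real.exp (-u j)) := by
            rw [Finset.sum_const, nsmul_eq_mul]
        _ ≤ Real.exp (u j) * (2 ^ n * 4 * Real.exp (-u j)) := by
            gcongr
            exact hQcard j
        _ = 2 ^ n * 4 := by
            rw [Real.exp_neg]
            field_simp
    have h2 : ∑ ε, b j ε = r j * (2 ^ n * u j +
        ∑ ε, ∑ p ∈ Q j, Real.exp (|Z ε p| / r j - u j)) := by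
      simp only [b]
      rw [← Finset.mul_sum, Finset.sum_add_distrib]
      simp
    rw [h2]
    calc _ ≤ r j * (2 ^ n * u j + 2 ^ n * 4) := by
          have := hr j
          gcongr
      _ ≤ r j * (2 ^ n * ((3 * K + 4) * (j + 1))) := by
          have := hr j
          gcongr
          have : (0 : ℝ) ≤ 2 ^ n * j := by positivity
          simp only [u]
          nlinarith
      _ = _ := by
          simp only [r]
          ring
  -- the truncation level
  obtain ⟨J, hJ⟩ : ∃ J : ℕ, (∑ i, g i) * (K / 2 ^ J) ≤ s := by
    obtain ⟨J, hJ⟩ := pow_unbounded_of_one_lt ((∑ i, g i) * K / s) (one_lt_two (α := ℝ))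
    refine ⟨J, ?_⟩
    rw [div_lt_iff₀ hs] at hJ
    rw [← mul_div_assoc, div_le_iff₀ (by positivity)]
    linarith
  -- `J` is independent of `ε` and `β`. The added `s` covers the step from `π J` to `β`, estimated
  -- without sign cancellation.
  refine ⟨fun ε => ∑ j ∈ Finset.range J, b j ε + s, ?_, ?_⟩
  · intro ε β hβ
    choose! π hπN hπd using fun j => hNnear j β hβ
    have hπ0 : π 0 = β₀ := by
      have := hπN 0
      rwa [hN0, Finset.mem_singleton] at this
    have hlink : ∀ j, |Z ε (π (j + 1), π j)| ≤ b j ε := by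
      intro j
      apply hb
      simp only [Q, Finset.mem_filter, Finset.mem_product]
      refine ⟨⟨hπN _, hπN _⟩, ?_⟩
      have h1 := hπd j
      have h2 := hπd (j + 1)
      have h3 : K / 2 ^ (j + 1) ≤ K / 2 ^ j := by
        apply div_le_div_of_nonneg_left hK.le (by positivity)
        exact pow_le_pow_right₀ one_le_two (Nat.le_succ j)
      have h4 := dist_triangle_left (π (j + 1)) (π j) β
      have h5 : 2 * K / 2 ^ j = K / 2 ^ j + K / 2 ^ j := by ring
      linarith
    have htel : ∑ i, signVal (ε i) * (a β i - a β₀ i)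
        = ∑ j ∈ Finset.range J, Z ε (π (j + 1), π j) + Z ε (β, π J) := by
      simp only [Z]
      rw [Finset.sum_comm, ← Finset.sum_add_distrib]
      refine Finset.sum_congr rfl fun i _ => ?_
      rw [← Finset.mul_sum, Finset.sum_range_sub (fun j => a (π j) i), hπ0]
      ring
    have hlast : |Z ε (β, π J)| ≤ s := by
      refine le_trans ?_ hJ
      rw [Finset.sum_mul]
      refine (Finset.abs_sum_le_sum_abs _ _).trans (Finset.sum_le_sum fun i _ => ?_)
      rw [abs_mul, abs_signVal, one_mul]
      exact (hlip _ hβ _ (hND _ _ (hπN J)) i).trans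
        (mul_le_mul_of_nonneg_left (hπd J) (hg i))
    rw [htel]
    refine (abs_add_le _ _).trans (add_le_add ?_ hlast)
    exact (Finset.abs_sum_le_sum_abs _ _).trans (Finset.sum_le_sum fun j _ => hlink j)
  · rw [Finset.sum_add_distrib, Finset.sum_comm]
    have h1 := Finset.sum_le_sum fun j (_ : j ∈ Finset.range J) => hbsum j
    rw [← Finset.mul_sum, ← Finset.mul_sum] at h1
    have h2 : s * (2 * K * (3 * K + 4)) * ∑ j ∈ Finset.range J, ((j : ℝ) + 1) / 2 ^ j ≤
        s * (2 * K * (3 * K + 4)) * 4 := by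
      gcongr
      exact sum_succ_div_two_pow_le J
    have h3 : ∑ _ε : Fin n → Bool, s = 2 ^ n * s := by simp
    rw [h3]
    have h4 := h1.trans (mul_le_mul_of_nonneg_left h2 (by positivity))
    linarith

end PanIC

namespace PanIC

/-! ### Symmetrization and the mean uniform deviation. -/

/-- The mean is an integral over an independent copy of the sample, and the norm of an integral is
at most the integral of the norm. Countability of `D` makes the supremum measurable. -/
theorem lintegral_iSup_enorm_sum_sub_integral_le {𝒳 E : Type*} [MeasurableSpace 𝒳]
    (PX : Measure 𝒳) [IsProbabilityMeasure PX] {D : Set E} (hD : D.Countable) {f : E → 𝒳 → ℝ}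
    (hf : ∀ β ∈ D, Measurable (f β)) (hfi : ∀ β ∈ D, Integrable (f β) PX) (n : ℕ) :
    ∫⁻ x, ⨆ β ∈ D, ‖∑ i, (f β (x i) - ∫ t, f β t ∂PX)‖ₑ ∂(Measure.pi fun _ : Fin n => PX) ≤
      ∫⁻ y, ⨆ β ∈ D, ‖∑ i, (f β (y i).1 - f β (y i).2)‖ₑ
        ∂(Measure.pi fun _ : Fin n => PX.prod PX) := by
  set ν := Measure.pi fun _ : Fin n => PX
  have hmeas : Measurable fun z : (Fin n → 𝒳) × (Fin n → 𝒳) =>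
      ⨆ β ∈ D, ‖∑ i, (f β (z.1 i) - f β (z.2 i))‖ₑ := by
    refine Measurable.biSup _ hD fun β hβ => ?_
    have := hf β hβ
    fun_prop
  have hmp := measurePreserving_arrowProdEquivProdArrow 𝒳 𝒳 (Fin n) (fun _ => PX) (fun _ => PX)
  have h1 := hmp.lintegral_comp hmeas
  have h2 : ∫⁻ y, ⨆ β ∈ D, ‖∑ i, (f β (y i).1 - f β (y i).2)‖ₑ
        ∂(Measure.pi fun _ : Fin n => PX.prod PX) =
      ∫⁻ z, ⨆ β ∈ D, ‖∑ i, (f β (z.1 i) - f β (z.2 i))‖ₑ ∂(ν.prod ν) := h1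
  rw [h2, lintegral_prod _ hmeas.aemeasurable]
  refine lintegral_mono fun x => iSup₂_le fun β hβ => ?_
  have hint : ∀ i, Integrable (fun z : Fin n → 𝒳 => f β (z i)) ν := fun i =>
    (measurePreserving_eval (fun _ : Fin n => PX) i).integrable_comp_of_integrable (hfi β hβ)
  have hval : ∀ i, ∫ z : Fin n → 𝒳, f β (z i) ∂ν = ∫ t, f β t ∂PX := fun i => by
    have h3 := measurePreserving_eval (fun _ : Fin n => PX) i
    have h4 := integral_map (μ := ν) (φ := Function.eval i) h3.measurable.aemeasurable
      (f := f β) (hf β hβ).aestronglyMeasurable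
    rw [h3.map_eq] at h4
    exact h4.symm
  have h3 : ∑ i, (f β (x i) - ∫ t, f β t ∂PX) = ∫ z, ∑ i, (f β (x i) - f β (z i)) ∂ν := by
    rw [integral_finsetSum (f := fun i (z : Fin n → 𝒳) => f β (x i) - f β (z i)) _
      fun i _ => (integrable_const _).sub (hint i)]
    refine Finset.sum_congr rfl fun i _ => ?_
    rw [integral_sub (integrable_const _) (hint i), hval]
    simp
  rw [h3]
  refine (enorm_integral_le_lintegral_enorm _).trans (lintegral_mono fun z => ?_)
  exact le_iSup₂_of_le β hβ le_rfl

/-- Swapping the two entries of a pair preserves the measure and flips the sign of its increment, so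
all 2^n sign patterns have the same integral. -/
theorem two_pow_mul_lintegral_iSup_symm {𝒳 E : Type*} [MeasurableSpace 𝒳]
    (PX : Measure 𝒳) [IsProbabilityMeasure PX] {D : Set E} (hD : D.Countable) {f : E → 𝒳 → ℝ}
    (hf : ∀ β ∈ D, Measurable (f β)) (n : ℕ) :
    2 ^ n * ∫⁻ y, ⨆ β ∈ D, ‖∑ i, (f β (y i).1 - f β (y i).2)‖ₑ
        ∂(Measure.pi fun _ : Fin n => PX.prod PX) =
      ∫⁻ y, ∑ ε : Fin n → Bool,
        ⨆ β ∈ D, ‖∑ i, signVal (ε i) * (f β (y i).1 - f β (y i).2)‖ₑ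
        ∂(Measure.pi fun _ : Fin n => PX.prod PX) := by
  have hmeas : ∀ ε : Fin n → Bool, Measurable fun y : Fin n → 𝒳 × 𝒳 =>
      ⨆ β ∈ D, ‖∑ i, signVal (ε i) * (f β (y i).1 - f β (y i).2)‖ₑ := by
    intro ε
    refine Measurable.biSup _ hD fun β hβ => ?_
    have := hf β hβ
    fun_prop
  have hmeas' : Measurable fun y : Fin n → 𝒳 × 𝒳 =>
      ⨆ β ∈ D, ‖∑ i, (f β (y i).1 - f β (y i).2)‖ₑ := by
    refine Measurable.biSup _ hD fun β hβ => ?_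
    have := hf β hβ
    fun_prop
  rw [lintegral_finsetSum _ fun ε _ => hmeas ε]
  have h1 : ∀ ε : Fin n → Bool,
      ∫⁻ y, ⨆ β ∈ D, ‖∑ i, signVal (ε i) * (f β (y i).1 - f β (y i).2)‖ₑ
        ∂(Measure.pi fun _ : Fin n => PX.prod PX) =
      ∫⁻ y, ⨆ β ∈ D, ‖∑ i, (f β (y i).1 - f β (y i).2)‖ₑ
        ∂(Measure.pi fun _ : Fin n => PX.prod PX) := by
    intro ε
    have hmp := measurePreserving_pi (fun _ : Fin n => PX.prod PX) (fun _ => PX.prod PX)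
      (f := fun i => if ε i then id else Prod.swap) (fun i => by
        split_ifs
        · exact MeasurePreserving.id _
        · exact Measure.measurePreserving_swap)
    rw [← hmp.lintegral_comp hmeas']
    refine lintegral_congr fun y => iSup_congr fun β => iSup_congr fun _ => ?_
    congr 1
    refine Finset.sum_congr rfl fun i _ => ?_
    by_cases h : ε i <;> simp [h, signVal]
  simp only [h1, Finset.sum_const, Finset.card_univ, nsmul_eq_mul]
  simp

/-- The empirical process indexed by a bounded set of parameters, with a square integrable
Lipschitz constant, has uniform deviations of order `√n` in mean. -/
theorem exists_lintegral_iSup_deviation_le {𝒳 : Type*} [MeasurableSpace 𝒳] {q : ℕ}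
    (PX : Measure 𝒳) [IsProbabilityMeasure PX] {D : Set (EuclideanSpace ℝ (Fin q))}
    (hDc : D.Countable) (hDb : Bornology.IsBounded D) {β₀ : EuclideanSpace ℝ (Fin q)} (h₀ : β₀ ∈ D)
    {f : EuclideanSpace ℝ (Fin q) → 𝒳 → ℝ}
    (hf : ∀ β ∈ D, Measurable (f β)) (hfi : ∀ β ∈ D, Integrable (f β) PX)
    (hf₀ : ∀ x, f β₀ x = 0) {G : 𝒳 → ℝ} (hGm : Measurable G) (hG0 : ∀ x, 0 ≤ G x)
    (hG2 : Integrable (fun x => G x ^ 2) PX)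
    (hlip : ∀ β ∈ D, ∀ τ ∈ D, ∀ᵐ x ∂PX, |f β x - f τ x| ≤ G x * ‖β - τ‖) :
    ∃ C : ℝ, 0 ≤ C ∧ ∀ n : ℕ, 0 < n →
      ∫⁻ x, ⨆ β ∈ D, ‖∑ i, (f β (x i) - ∫ t, f β t ∂PX)‖ₑ ∂(Measure.pi fun _ : Fin n => PX) ≤
        ENNReal.ofReal (C * Real.sqrt n) := by
  obtain ⟨C, hC, hchain⟩ := rademacher_chaining hDb h₀
  -- a positive envelope for the symmetrized increments
  let g : 𝒳 × 𝒳 → ℝ := fun y => G y.1 + G y.2 + 1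
  have hg1 : ∀ y, 1 ≤ g y := fun y => by
    have h1 := hG0 y.1
    have h2 := hG0 y.2
    simp only [g]
    linarith
  have hgm : Measurable g := by fun_prop
  have hg2 : Integrable (fun y => g y ^ 2) (PX.prod PX) := by
    have h1 : MemLp G 2 PX := (memLp_two_iff_integrable_sq hGm.aestronglyMeasurable).mpr hG2
    have h2 : MemLp (fun y : 𝒳 × 𝒳 => G y.1) 2 (PX.prod PX) :=
      h1.comp_measurePreserving measurePreserving_fst
    have h3 : MemLp (fun y : 𝒳 × 𝒳 => G y.2) 2 (PX.prod PX) :=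
      h1.comp_measurePreserving measurePreserving_snd
    exact (memLp_two_iff_integrable_sq hgm.aestronglyMeasurable).mp
      ((h2.add h3).add (memLp_const 1))
  set V : ℝ := ∫ y, g y ^ 2 ∂(PX.prod PX) with hV
  have hV0 : 0 ≤ V := integral_nonneg fun y => sq_nonneg _
  -- From s ≤ (s²/√n + √n)/2, whose right side has mean √n (V + 1)/2 when s² is the sum of the
  -- squared envelopes.
  refine ⟨C * ((V + 1) / 2), by positivity, fun n hn => ?_⟩
  have hn' : (0 : ℝ) < n := by exact_mod_cast hn
  set ρ := Measure.pi fun _ : Fin n => PX.prod PX with hρ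
  refine (lintegral_iSup_enorm_sum_sub_integral_le PX hDc hf hfi n).trans ?_
  have h2n : (2 : ENNReal) ^ n ≠ 0 := by positivity
  have h2n' : (2 : ENNReal) ^ n ≠ ⊤ := by finiteness
  rw [← ENNReal.mul_le_mul_iff_right h2n h2n', two_pow_mul_lintegral_iSup_symm PX hDc hf n]
  -- almost surely all increments are Lipschitz
  have hae : ∀ᵐ y ∂(PX.prod PX), ∀ β ∈ D, ∀ τ ∈ D,
      |(f β y.1 - f β y.2) - (f τ y.1 - f τ y.2)| ≤ g y * dist β τ := by
    rw [ae_ball_iff hDc]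
    intro β hβ
    rw [ae_ball_iff hDc]
    intro τ hτ
    filter_upwards [Measure.quasiMeasurePreserving_fst.ae (hlip β hβ τ hτ),
      Measure.quasiMeasurePreserving_snd.ae (hlip β hβ τ hτ)] with y h1 h2
    have h3 : (f β y.1 - f β y.2) - (f τ y.1 - f τ y.2) =
      (f β y.1 - f τ y.1) - (f β y.2 - f τ y.2) := by ring
    rw [h3, dist_eq_norm]
    refine (abs_sub _ _).trans ?_
    have := norm_nonneg (β - τ)
    simp only [g]
    nlinarith
  have haen : ∀ᵐ y ∂ρ, ∀ i, ∀ β ∈ D, ∀ τ ∈ D,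
      |(f β (y i).1 - f β (y i).2) - (f τ (y i).1 - f τ (y i).2)| ≤ g (y i) * dist β τ := by
    rw [ae_all_iff]
    intro i
    exact (measurePreserving_eval (fun _ : Fin n => PX.prod PX) i).quasiMeasurePreserving.ae hae
  let s : (Fin n → 𝒳 × 𝒳) → ℝ := fun y => Real.sqrt (∑ i, g (y i) ^ 2)
  have hbound : ∀ᵐ y ∂ρ, ∑ ε : Fin n → Bool,
      ⨆ β ∈ D, ‖∑ i, signVal (ε i) * (f β (y i).1 - f β (y i).2)‖ₑ ≤
        ENNReal.ofReal (2 ^ n * (C * s y)) := by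
    filter_upwards [haen] with y hy
    -- The summand 1 in `g` ensures the strict positivity that `hchain` requires.
    have hs : 0 < ∑ i, g (y i) ^ 2 := by
      have : Nonempty (Fin n) := ⟨⟨0, hn⟩⟩
      exact Finset.sum_pos (fun i _ => by have := hg1 (y i); positivity) Finset.univ_nonempty
    obtain ⟨B, hB, hBsum⟩ := hchain n (fun β i => f β (y i).1 - f β (y i).2) (fun i => g (y i))
      (s y) (Real.sqrt_pos.mpr hs) (fun i => by linarith [hg1 (y i)])
      (fun β hβ τ hτ i => hy i β hβ τ hτ) (Real.sq_sqrt hs.le).ge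
    have hB0 : ∀ ε, 0 ≤ B ε := fun ε => (abs_nonneg _).trans (hB ε β₀ h₀)
    calc _ ≤ ∑ ε : Fin n → Bool, ENNReal.ofReal (B ε) := by
          refine Finset.sum_le_sum fun ε _ => iSup₂_le fun β hβ => ?_
          rw [Real.enorm_eq_ofReal_abs]
          apply ENNReal.ofReal_le_ofReal
          simpa [hf₀] using hB ε β hβ
      _ = ENNReal.ofReal (∑ ε, B ε) := (ENNReal.ofReal_sum_of_nonneg fun ε _ => hB0 ε).symm
      _ ≤ _ := ENNReal.ofReal_le_ofReal hBsum
  refine (lintegral_mono_ae hbound).trans ?_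
  -- the mean of the random Lipschitz constant
  have hs_le : ∀ y, s y ≤ ((∑ i, g (y i) ^ 2) / Real.sqrt n + Real.sqrt n) / 2 := by
    intro y
    have h1 : 0 ≤ ∑ i, g (y i) ^ 2 := Finset.sum_nonneg fun i _ => sq_nonneg _
    have h2 : 0 < Real.sqrt n := Real.sqrt_pos.mpr hn'
    have h3 : s y ^ 2 = ∑ i, g (y i) ^ 2 := Real.sq_sqrt h1
    rw [← h3, le_div_iff₀ two_pos, ← sub_nonneg]
    have : s y ^ 2 / √n + √n - s y * 2 = (s y - √n) ^ 2 / √n := by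
      field_simp
      ring
    rw [this]
    positivity
  have hint : ∀ i, Integrable (fun y : Fin n → 𝒳 × 𝒳 => g (y i) ^ 2) ρ := fun i =>
    (measurePreserving_eval (fun _ : Fin n => PX.prod PX) i).integrable_comp_of_integrable hg2
  have hval : ∀ i, ∫ y : Fin n → 𝒳 × 𝒳, g (y i) ^ 2 ∂ρ = V := fun i => by
    have h3 := measurePreserving_eval (fun _ : Fin n => PX.prod PX) i
    have h4 := integral_map (μ := ρ) (φ := Function.eval i) h3.measurable.aemeasurable
      (f := fun y => g y ^ 2) (hgm.pow_const 2).aestronglyMeasurable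
    rw [h3.map_eq] at h4
    exact h4.symm
  have hint' : Integrable (fun y : Fin n → 𝒳 × 𝒳 =>
      2 ^ n * (C * (((∑ i, g (y i) ^ 2) / Real.sqrt n + Real.sqrt n) / 2))) ρ :=
    (((((integrable_finsetSum _ fun i _ => hint i).div_const _).add
      (integrable_const _)).div_const _).const_mul _).const_mul _
  calc ∫⁻ y, ENNReal.ofReal (2 ^ n * (C * s y)) ∂ρ
      ≤ ∫⁻ y, ENNReal.ofReal
        (2 ^ n * (C * (((∑ i, g (y i) ^ 2) / Real.sqrt n + Real.sqrt n) / 2))) ∂ρ := by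
        refine lintegral_mono fun y => ENNReal.ofReal_le_ofReal ?_
        have := hs_le y
        gcongr
    _ = ENNReal.ofReal (2 ^ n * (C * ((n * V / Real.sqrt n + Real.sqrt n) / 2))) := by
        rw [← ofReal_integral_eq_lintegral_ofReal hint']
        · rw [integral_const_mul, integral_const_mul, integral_div,
            integral_add ((integrable_finsetSum _ fun i _ => hint i).div_const _)
              (integrable_const _), integral_div, integral_finsetSum _ fun i _ => hint i]
          simp [hval]
        · refine ae_of_all _ fun y => ?_
          simp only [Pi.zero_apply]
          positivity
    _ = 2 ^ n * ENNReal.ofReal (C * ((V + 1) / 2) * Real.sqrt n) := by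
        rw [ENNReal.ofReal_mul (by positivity), ENNReal.ofReal_pow (by norm_num),
          ENNReal.ofReal_ofNat]
        congr 2
        have : (n : ℝ) * V / √n = √n * V := by
          rw [mul_div_right_comm, Real.div_sqrt]
        rw [this]
        ring

end PanIC

namespace PanIC

/-! ### Existence of minimisers and continuity of the risk. -/

theorem isLeast_minOver {E : Type*} [TopologicalSpace E] {f : E → ℝ} {S : Set E}
    (hS : IsCompact S) (hne : S.Nonempty) (hf : ContinuousOn f S) :
    IsLeast (f '' S) (minOver f S) :=
  (hS.image_of_continuousOn hf).isLeast_sInf (hne.image f)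

/-- The lower semicontinuity half of Berge's maximum theorem. -/
theorem lowerSemicontinuousOn_minOver {α E : Type*} [TopologicalSpace α] [TopologicalSpace E]
    {T : α → Set E} {I : Set α} {S : Set E} {f : E → ℝ} (hT : UpperHemicontinuousOn T I)
    (hTS : ∀ k ∈ I, T k ⊆ S) (hTc : ∀ k ∈ I, IsCompact (T k)) (hTne : ∀ k ∈ I, (T k).Nonempty)
    (hS : IsClosed S) (hf : ContinuousOn f S) :
    LowerSemicontinuousOn (fun k => minOver f (T k)) I := by
  have hleast : ∀ k ∈ I, IsLeast (f '' T k) (minOver f (T k)) := fun k hk =>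
    isLeast_minOver (hTc k hk) (hTne k hk) (hf.mono (hTS k hk))
  rw [lowerSemicontinuousOn_iff]
  intro k hk
  rw [lowerSemicontinuousWithinAt_iff]
  intro y hy
  -- The complement of this sublevel set is an open neighbourhood of `T k`, so upper hemicontinuity
  -- puts nearby `T l` inside it.
  have hcl : IsClosed (S ∩ f ⁻¹' Set.Iic y) := hf.preimage_isClosed_of_isClosed hS isClosed_Iic
  have hsub : T k ⊆ (S ∩ f ⁻¹' Set.Iic y)ᶜ := by
    rintro β hβ ⟨-, hβy⟩
    exact absurd (hy.trans_le ((hleast k hk).2 ⟨β, hβ, rfl⟩)) (not_lt.mpr hβy)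
  filter_upwards [hT.forall_isOpen k hk _ hcl.isOpen_compl hsub, self_mem_nhdsWithin] with l hl hlI
  obtain ⟨β, hβ, hβl⟩ := (hleast l hlI).1
  rw [← hβl]
  exact not_le.mp fun h => hl hβ ⟨hTS l hlI hβ, h⟩

/-- The set of minimisers is the sublevel set at the minimum value, hence compact under lower
semicontinuity, and contains its infimum. -/
theorem isLeast_argminOver {a b : ℝ} (hab : a ≤ b) {f : ℝ → ℝ}
    (hf : LowerSemicontinuousOn f (Set.Icc a b)) :
    IsLeast (argminOver f (Set.Icc a b)) (sInf (argminOver f (Set.Icc a b))) := by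
  obtain ⟨k, hk, hmin⟩ := hf.exists_isMinOn (Set.nonempty_Icc.mpr hab) isCompact_Icc
  have heq : argminOver f (Set.Icc a b) = Set.Icc a b ∩ f ⁻¹' Set.Iic (f k) := by
    ext l
    refine ⟨fun h => ⟨h.1, h.2 hk⟩, fun h => ⟨h.1, fun x hx => ?_⟩⟩
    exact (show f l ≤ f k from h.2).trans (isMinOn_iff.mp hmin x hx)
  rw [heq]
  exact (hf.isCompact_inter_preimage_Iic isCompact_Icc _).isLeast_sInf ⟨k, hk, le_refl (f k)⟩

theorem continuousOn_empiricalRisk {𝒳 E Ω : Type*} [TopologicalSpace E] {L : 𝒳 → E → ℝ} {S : Set E}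
    (hL : ∀ x, ContinuousOn (L x) S) (X : ℕ → Ω → 𝒳) (n : ℕ) (ω : Ω) :
    ContinuousOn (empiricalRisk L X n ω) S :=
  continuousOn_const.mul (continuousOn_finsetSum _ fun i _ => hL (X i ω))

section Risk

variable {𝒳 E : Type*} [MeasurableSpace 𝒳] [NormedAddCommGroup E] {PX : Measure 𝒳}
  [IsProbabilityMeasure PX] {L : 𝒳 → E → ℝ} {S : Set E}

theorem integrable_of_integrable_sq {f : 𝒳 → ℝ} (hf : Measurable f)
    (hf2 : Integrable (fun x => f x ^ 2) PX) : Integrable f PX :=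
  ((memLp_two_iff_integrable_sq hf.aestronglyMeasurable).mpr hf2).integrable one_le_two

theorem integrable_loss (h1 : CondA1 L S) (h2 : CondA2 PX L S) (h3 : CondA3 PX L S) {β : E}
    (hβ : β ∈ S) : Integrable (fun x => L x β) PX := by
  obtain ⟨-, τ, hτ, hτ2⟩ := h2
  obtain ⟨G, hGm, hG0, hG2, hlip⟩ := h3
  have hG := integrable_of_integrable_sq hGm hG2
  have hτi := integrable_of_integrable_sq (h1.2 τ hτ) hτ2
  have hd : Integrable (fun x => L x β - L x τ) PX := by
    refine (hG.mul_const ‖β - τ‖).mono' ((h1.2 β hβ).sub (h1.2 τ hτ)).aestronglyMeasurable ?_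
    filter_upwards [hlip β hβ τ hτ] with x hx
    rwa [Real.norm_eq_abs]
  refine (hd.add hτi).congr (ae_of_all _ fun x => ?_)
  simp

theorem continuousOn_expectedRisk (h1 : CondA1 L S) (h2 : CondA2 PX L S) (h3 : CondA3 PX L S) :
    ContinuousOn (expectedRisk PX L) S := by
  have hi := fun β (hβ : β ∈ S) => integrable_loss h1 h2 h3 hβ
  obtain ⟨G, hGm, hG0, hG2, hlip⟩ := h3
  have hG := integrable_of_integrable_sq hGm hG2
  have hlipr : LipschitzOnWith (∫ x, G x ∂PX).toNNReal (expectedRisk PX L) S := by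
    refine LipschitzOnWith.of_dist_le_mul fun β hβ τ hτ => ?_
    rw [Real.coe_toNNReal _ (integral_nonneg hG0), Real.dist_eq, dist_eq_norm]
    simp only [expectedRisk]
    rw [← integral_sub (hi β hβ) (hi τ hτ), ← integral_mul_const]
    refine (abs_integral_le_integral_abs).trans
      (integral_mono_ae ((hi β hβ).sub (hi τ hτ)).abs (hG.mul_const _) (hlip β hβ τ hτ))
  exact hlipr.continuousOn

end Risk

/-! ### Uniform deviations of the empirical risk. -/

/-- Uniform `√n`-tightness of the increments of the empirical risk. -/
theorem exists_measure_deviation_le {𝒳 Ω : Type*} [MeasurableSpace 𝒳] [MeasurableSpace Ω]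
    {μ : Measure Ω} [IsProbabilityMeasure μ] {q : ℕ} {PX : Measure 𝒳} [IsProbabilityMeasure PX]
    {X : ℕ → Ω → 𝒳} (hX_indep : iIndepFun X μ) (hX_law : ∀ i, HasLaw (X i) PX μ)
    {L : 𝒳 → EuclideanSpace ℝ (Fin q) → ℝ} {S : Set (EuclideanSpace ℝ (Fin q))}
    (h1 : CondA1 L S) (h2 : CondA2 PX L S) (h3 : CondA3 PX L S)
    {β₀ : EuclideanSpace ℝ (Fin q)} (h₀ : β₀ ∈ S) :
    ∃ C : ℝ, 0 ≤ C ∧ ∀ n : ℕ, 0 < n → ∀ M : ℝ, 0 < M →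
      μ {ω | ¬ ∀ β ∈ S, |(empiricalRisk L X n ω β - empiricalRisk L X n ω β₀) -
        (expectedRisk PX L β - expectedRisk PX L β₀)| ≤ M / Real.sqrt n} ≤
        ENNReal.ofReal (C / M) := by
  have hi := fun β (hβ : β ∈ S) => integrable_loss h1 h2 h3 hβ
  have hrc := continuousOn_expectedRisk h1 h2 h3
  obtain ⟨D', hD'S, hD'c, hD'⟩ := TopologicalSpace.IsSeparable.exists_countable_dense_subset
    h2.1.isSeparable
  obtain ⟨G, hGm, hG0, hG2, hlip⟩ := h3
  -- Including `β₀` lets it serve as the base point of the chaining, with `f β₀ = 0`.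
  let D := insert β₀ D'
  have hDS : D ⊆ S := Set.insert_subset h₀ hD'S
  have hDc : D.Countable := hD'c.insert β₀
  have hD : S ⊆ closure D := hD'.trans (closure_mono (Set.subset_insert _ _))
  let f : EuclideanSpace ℝ (Fin q) → 𝒳 → ℝ := fun β x => L x β - L x β₀
  have hfm : ∀ β ∈ D, Measurable (f β) := fun β hβ => (h1.2 β (hDS hβ)).sub (h1.2 β₀ h₀)
  have hfi : ∀ β ∈ D, Integrable (f β) PX := fun β hβ => (hi β (hDS hβ)).sub (hi β₀ h₀)
  have hfr : ∀ β ∈ D, ∫ t, f β t ∂PX = expectedRisk PX L β - expectedRisk PX L β₀ :=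
    fun β hβ => integral_sub (hi β (hDS hβ)) (hi β₀ h₀)
  obtain ⟨C, hC, hmean⟩ := exists_lintegral_iSup_deviation_le PX hDc
    (h2.1.isBounded.subset hDS) (Set.mem_insert _ _ : β₀ ∈ D) hfm hfi (fun x => sub_self _)
    hGm hG0 hG2 (fun β hβ τ hτ => by
      filter_upwards [hlip β (hDS hβ) τ (hDS hτ)] with x hx
      simpa only [f, sub_sub_sub_cancel_right] using hx)
  refine ⟨C, hC, fun n hn M hM => ?_⟩
  have hn' : (0 : ℝ) < n := by exact_mod_cast hn
  have hsn : 0 < Real.sqrt n := Real.sqrt_pos.mpr hn'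
  let V : (Fin n → 𝒳) → ENNReal := fun x => ⨆ β ∈ D, ‖∑ i, (f β (x i) - ∫ t, f β t ∂PX)‖ₑ
  have hVm : Measurable V := by
    refine Measurable.biSup _ hDc fun β hβ => ?_
    have := hfm β hβ
    fun_prop
  let Y : Ω → Fin n → 𝒳 := fun ω i => X i ω
  have hYm : AEMeasurable Y μ := aemeasurable_pi_lambda _ fun i => (hX_law i).aemeasurable
  have hYmap : μ.map Y = Measure.pi fun _ : Fin n => PX := by
    have := iIndepFun.map_fun_eq_pi_map (f := fun i : Fin n => X i)
      (fun i => (hX_law i).aemeasurable) (hX_indep.precomp Fin.val_injective)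
    refine this.trans ?_
    congr 1
    funext i
    exact (hX_law i).map_eq
  -- Continuity in the parameter extends the bound from the countable dense set to `S`. Inclusion in
  -- an event defined by `V` avoids having to show that the left side is measurable.
  have hsub : {ω | ¬ ∀ β ∈ S, |(empiricalRisk L X n ω β - empiricalRisk L X n ω β₀) -
        (expectedRisk PX L β - expectedRisk PX L β₀)| ≤ M / Real.sqrt n} ⊆
      {ω | ENNReal.ofReal (M * Real.sqrt n) ≤ V (Y ω)} := by
    intro ω hω
    by_contra hV
    apply hω
    rw [Set.mem_ofPred_eq, not_le] at hV
    have hcl : IsClosed (S ∩ (fun β =>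
        |(empiricalRisk L X n ω β - empiricalRisk L X n ω β₀) -
        (expectedRisk PX L β - expectedRisk PX L β₀)|) ⁻¹' Set.Iic (M / Real.sqrt n)) := by
      refine ContinuousOn.preimage_isClosed_of_isClosed ?_ h2.1.isClosed isClosed_Iic
      exact (((continuousOn_empiricalRisk h1.1 X n ω).sub continuousOn_const).sub
        (hrc.sub continuousOn_const)).abs
    have hDsub : D ⊆ (S ∩ (fun β =>
        |(empiricalRisk L X n ω β - empiricalRisk L X n ω β₀) -
        (expectedRisk PX L β - expectedRisk PX L β₀)|) ⁻¹' Set.Iic (M / Real.sqrt n)) := by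
      intro β hβ
      refine ⟨hDS hβ, ?_⟩
      have h4 : ‖∑ i, (f β (Y ω i) - ∫ t, f β t ∂PX)‖ₑ ≤ ENNReal.ofReal (M * Real.sqrt n) :=
        (le_iSup₂ (f := fun β (_ : β ∈ D) => ‖∑ i, (f β (Y ω i) - ∫ t, f β t ∂PX)‖ₑ)
          β hβ).trans hV.le
      rw [Real.enorm_eq_ofReal_abs, ENNReal.ofReal_le_ofReal_iff (by positivity)] at h4
      have h5 : (empiricalRisk L X n ω β - empiricalRisk L X n ω β₀) -
          (expectedRisk PX L β - expectedRisk PX L β₀) =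
          (∑ i, (f β (Y ω i) - ∫ t, f β t ∂PX)) / n := by
        rw [Finset.sum_sub_distrib, hfr β hβ]
        simp only [f, Y, Finset.sum_sub_distrib, Finset.sum_const, Finset.card_univ,
          Fintype.card_fin, nsmul_eq_mul, empiricalRisk, Finset.sum_range]
        field_simp
      rw [Set.mem_preimage, Set.mem_Iic, h5, abs_div, abs_of_pos hn', div_le_iff₀ hn']
      refine h4.trans_eq ?_
      rw [div_mul_eq_mul_div, mul_div_assoc, Real.div_sqrt]
    exact fun β hβ => (closure_minimal hDsub hcl (hD hβ)).2
  have hmarkov := mul_meas_ge_le_lintegral₀ (hVm.comp_aemeasurable hYm)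
    (ENNReal.ofReal (M * Real.sqrt n))
  have hint : ∫⁻ ω, V (Y ω) ∂μ ≤ ENNReal.ofReal (C * Real.sqrt n) := by
    rw [← lintegral_map' (hVm.aemeasurable) hYm, hYmap]
    exact hmean n hn
  have hpos : 0 < M * Real.sqrt n := by positivity
  have h6 : C / M = C * Real.sqrt n / (M * Real.sqrt n) := by field_simp
  rw [h6, ENNReal.ofReal_div_of_pos hpos, ENNReal.le_div_iff_mul_le
    (Or.inl (by simpa using hpos)) (Or.inl ENNReal.ofReal_ne_top), mul_comm]
  exact (mul_le_mul_right (measure_mono hsub) _).trans (hmarkov.trans hint)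

end PanIC

/-! ### Consistency of the selected index. -/

theorem mainTheorem1 {Ω : Type*} [MeasurableSpace Ω] (μ : Measure Ω) [IsProbabilityMeasure μ]
    {d q : ℕ} (𝕏 : Set (EuclideanSpace ℝ (Fin d))) (PX : Measure 𝕏)
    -- the i.i.d. sequence with common law `PX`
    (X : ℕ → Ω → 𝕏) (hX_indep : iIndepFun X μ) (hX_law : ∀ i, HasLaw (X i) PX μ)
    -- the hypotheses `h(· ; β)`, the loss function, and the index interval
    (h : 𝕏 → EuclideanSpace ℝ (Fin q) → ℝ) (ℓ : ℝ → ℝ) (a b : ℝ) (hab : a < b)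
    -- the nested, continuous correspondence of parameter sets (compact-valued by A2)
    (T : ℝ → Set (EuclideanSpace ℝ (Fin q)))
    (hT_upper : UpperHemicontinuousOn T (Set.Icc a b))
    (hT_lower : LowerHemicontinuousOn T (Set.Icc a b))
    (hT_nested : MonotoneOn T (Set.Icc a b))
    (hA1 : ∀ k ∈ Set.Icc a b, PanIC.CondA1 (PanIC.loss ℓ h) (T k))
    (hA2 : ∀ k ∈ Set.Icc a b, PanIC.CondA2 PX (PanIC.loss ℓ h) (T k))
    (hA3 : ∀ k ∈ Set.Icc a b, PanIC.CondA3 PX (PanIC.loss ℓ h) (T k))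
    -- the random penalty `P k n`
    (P : ℝ → ℕ → Ω → ℝ)
    (hP_meas : ∀ k ∈ Set.Icc a b, ∀ n, 0 < n → AEMeasurable (P k n) μ)
    (hP_cont : ∀ n, 0 < n → ∀ᵐ ω ∂μ, ContinuousOn (fun k => P k n ω) (Set.Icc a b))
    (hP_mono : ∀ n, 0 < n → ∀ᵐ ω ∂μ, StrictMonoOn (fun k => P k n ω) (Set.Icc a b))
    (hB1 : ∀ k ∈ Set.Icc a b, PanIC.CondB1 μ (P k))
    (hB2 : PanIC.CondB2 μ a b P) :
    -- the minimal risks are attained and `k*` is well defined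
    (∀ k ∈ Set.Icc a b,
      IsLeast (PanIC.expectedRisk PX (PanIC.loss ℓ h) '' T k)
        (PanIC.minOver (PanIC.expectedRisk PX (PanIC.loss ℓ h)) (T k))) ∧
    IsLeast (PanIC.optimalIndices a b T (PanIC.expectedRisk PX (PanIC.loss ℓ h)))
      (PanIC.optimalIndex a b T (PanIC.expectedRisk PX (PanIC.loss ℓ h))) ∧
    -- the minimal empirical risks are attained and the estimator is almost surely well defined
    (∀ n, 0 < n → ∀ ω, ∀ k ∈ Set.Icc a b,
      IsLeast (PanIC.empiricalRisk (PanIC.loss ℓ h) X n ω '' T k)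
        (PanIC.minOver (PanIC.empiricalRisk (PanIC.loss ℓ h) X n ω) (T k))) ∧
    (∀ n, 0 < n → ∀ᵐ ω ∂μ,
      IsLeast (PanIC.selectedIndices a b T (PanIC.loss ℓ h) X P n ω)
        (PanIC.estimator a b T (PanIC.loss ℓ h) X P n ω)) ∧
    -- the estimator converges in probability to `k*`
    TendstoInMeasure μ (PanIC.estimator a b T (PanIC.loss ℓ h) X P) atTop
      (fun _ => PanIC.optimalIndex a b T (PanIC.expectedRisk PX (PanIC.loss ℓ h)))
  := by
  have hPX : IsProbabilityMeasure PX := by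
    rw [← (hX_law 0).map_eq]
    exact Measure.isProbabilityMeasure_map (hX_law 0).aemeasurable
  have ha : a ∈ Set.Icc a b := Set.left_mem_Icc.mpr hab.le
  have hb : b ∈ Set.Icc a b := Set.right_mem_Icc.mpr hab.le
  have hTb : ∀ k ∈ Set.Icc a b, T k ⊆ T b := fun k hk => hT_nested hk hb hk.2
  have hTc : ∀ k ∈ Set.Icc a b, IsCompact (T k) := fun k hk => (hA2 k hk).1
  have hTne : ∀ k ∈ Set.Icc a b, (T k).Nonempty := fun k hk =>
    let ⟨τ, hτ, _⟩ := (hA2 k hk).2; ⟨τ, hτ⟩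
  set L := PanIC.loss ℓ h
  set r := PanIC.expectedRisk PX L with hr
  have hrc : ContinuousOn r (T b) :=
    PanIC.continuousOn_expectedRisk (hA1 b hb) (hA2 b hb) (hA3 b hb)
  have hRc : ∀ n ω, ContinuousOn (PanIC.empiricalRisk L X n ω) (T b) :=
    PanIC.continuousOn_empiricalRisk (hA1 b hb).1 X
  have hlsc : ∀ f, ContinuousOn f (T b) →
      LowerSemicontinuousOn (fun k => PanIC.minOver f (T k)) (Set.Icc a b) := fun f hf =>
    PanIC.lowerSemicontinuousOn_minOver hT_upper hTb hTc hTne (hTc b hb).isClosed hf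
  have hmin : ∀ f, ContinuousOn f (T b) → ∀ k ∈ Set.Icc a b,
      IsLeast (f '' T k) (PanIC.minOver f (T k)) := fun f hf k hk =>
    PanIC.isLeast_minOver (hTc k hk) (hTne k hk) (hf.mono (hTb k hk))
  have hopt : IsLeast (PanIC.optimalIndices a b T r) (PanIC.optimalIndex a b T r) :=
    PanIC.isLeast_argminOver hab.le (hlsc r hrc)
  have hest : ∀ n, 0 < n → ∀ᵐ ω ∂μ, IsLeast (PanIC.selectedIndices a b T L X P n ω)
      (PanIC.estimator a b T L X P n ω) := by
    intro n hn
    filter_upwards [hP_cont n hn] with ω hω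
    exact PanIC.isLeast_argminOver hab.le ((hlsc _ (hRc n ω)).add hω.lowerSemicontinuousOn)
  refine ⟨hmin r hrc, hopt, fun n _ ω => hmin _ (hRc n ω), hest, ?_⟩
  set κ := PanIC.optimalIndex a b T r
  set m : ℝ → ℝ := fun k => PanIC.minOver r (T k) with hm
  have hκ : κ ∈ Set.Icc a b := hopt.1.1
  have hmκ : ∀ k ∈ Set.Icc a b, m κ ≤ m k := isMinOn_iff.mp hopt.1.2
  have hmono : ∀ k ∈ Set.Icc a b, ∀ l ∈ Set.Icc a b, k ≤ l → m l ≤ m k := by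
    intro k hk l hl hkl
    obtain ⟨β, hβ, hβk⟩ := (hmin r hrc k hk).1
    exact ((hmin r hrc l hl).2 ⟨β, hT_nested hk hl hkl hβ, rfl⟩).trans_eq hβk
  -- Strict because `κ` is the least optimal index; this is what makes underestimation costly.
  have hgap : ∀ k ∈ Set.Icc a b, k < κ → m κ < m k := by
    intro k hk hkκ
    by_contra hle
    refine absurd (hopt.2 ⟨hk, isMinOn_iff.mpr fun l hl => ?_⟩) (not_le.mpr hkκ)
    exact (not_lt.mp hle).trans (hmκ l hl)
  obtain ⟨β₀, hβ₀, hβ₀m⟩ := (hmin r hrc κ hκ).1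
  obtain ⟨C, hC, hdev⟩ := PanIC.exists_measure_deviation_le hX_indep hX_law
    (hA1 b hb) (hA2 b hb) (hA3 b hb) (hTb κ hκ hβ₀)
  let Dev : ℕ → ℝ → Set Ω := fun n M => {ω | ¬ ∀ β ∈ T b,
    |(PanIC.empiricalRisk L X n ω β - PanIC.empiricalRisk L X n ω β₀) - (r β - r β₀)| ≤
      M / Real.sqrt n}
  set κn : ℕ → Ω → ℝ := PanIC.estimator a b T L X P
  -- the basic inequality for the selected index
  have hbasic : ∀ n, 0 < n → ∀ᵐ ω ∂μ, κn n ω ∈ Set.Icc a b ∧ ∀ M, ω ∉ Dev n M →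
      m (κn n ω) - m κ + P (κn n ω) n ω - P κ n ω ≤ M / Real.sqrt n := by
    intro n hn
    filter_upwards [hest n hn] with ω hω
    have hκn : κn n ω ∈ Set.Icc a b := hω.1.1
    refine ⟨hκn, fun M hM => ?_⟩
    have hM' : ∀ β ∈ T b, |(PanIC.empiricalRisk L X n ω β - PanIC.empiricalRisk L X n ω β₀) -
        (r β - r β₀)| ≤ M / Real.sqrt n := by
      by_contra hcon
      exact hM hcon
    obtain ⟨β, hβ, hβm⟩ := (hmin _ (hRc n ω) _ hκn).1
    -- The selected pair is compared with `(κ, β₀)`; only increments of the empirical risk from `β₀`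
    -- enter.
    have e1 := isMinOn_iff.mp hω.1.2 κ hκ
    have e2 := (hmin _ (hRc n ω) κ hκ).2 ⟨β₀, hβ₀, rfl⟩
    have e3 := (hmin r hrc _ hκn).2 ⟨β, hβ, rfl⟩
    have e4 := (abs_le.mp (hM' β (hTb _ hκn hβ))).1
    have e5 : m κ = r β₀ := hβ₀m.symm
    have e6 : m (κn n ω) = PanIC.minOver r (T (κn n ω)) := rfl
    linarith
  rw [tendstoInMeasure_iff_dist]
  intro σ hσ
  -- overestimation
  have hupper : Tendsto (fun n => μ {ω | κ + σ ≤ κn n ω}) atTop (𝓝 0) := by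
    -- Outside `[a, b]` the event is null, since the estimator almost surely lies in the interval.
    by_cases hk : κ + σ ∈ Set.Icc a b
    swap
    · refine tendsto_const_nhds.congr' ?_
      filter_upwards [eventually_gt_atTop 0] with n hn
      symm
      rw [← nonpos_iff_eq_zero]
      refine (measure_mono_ae ?_).trans (measure_empty (μ := μ)).le
      filter_upwards [hbasic n hn] with ω hω hle
      exact hk ⟨by linarith [hκ.1], le_trans hle hω.1.2⟩
    · rw [ENNReal.tendsto_nhds_zero]
      intro ε hε
      have hε2 : 0 < ε / 2 := ENNReal.half_pos hε.ne'
      have hM0 : Tendsto (fun M : ℝ => ENNReal.ofReal (C / M)) atTop (𝓝 0) := by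
        have := ENNReal.tendsto_ofReal (tendsto_const_nhds (x := C).div_atTop tendsto_id)
        simpa using this
      obtain ⟨M, hMε, hM⟩ := ((ENNReal.tendsto_nhds_zero.mp hM0 _ hε2).and
        (eventually_gt_atTop 0)).exists
      have hB := ENNReal.tendsto_nhds_zero.mp (hB2 κ hκ _ hk (by linarith) M) _ hε2
      filter_upwards [hB, eventually_gt_atTop 0] with n hn hn0
      have hsn : 0 < Real.sqrt n := Real.sqrt_pos.mpr (by exact_mod_cast hn0)
      calc μ {ω | κ + σ ≤ κn n ω}
          ≤ μ (Dev n M ∪ {ω | Real.sqrt n * (P (κ + σ) n ω - P κ n ω) ≤ M}) := by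
            refine measure_mono_ae ?_
            filter_upwards [hbasic n hn0, hP_mono n hn0] with ω hω hωm hle
            by_cases hD : ω ∈ Dev n M
            · exact Or.inl hD
            · refine Or.inr ?_
              have e1 := hω.2 M hD
              have e2 := hmκ _ hω.1
              -- Monotonicity replaces the random index by the fixed `κ + σ`, to which B2 applies.
              have e3 : P (κ + σ) n ω ≤ P (κn n ω) n ω := hωm.monotoneOn hk hω.1 hle
              have e4 : P (κ + σ) n ω - P κ n ω ≤ M / Real.sqrt n := by linarith
              rw [le_div_iff₀ hsn] at e4
              change Real.sqrt n * (P (κ + σ) n ω - P κ n ω) ≤ M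
              linarith
        _ ≤ μ (Dev n M) + μ {ω | Real.sqrt n * (P (κ + σ) n ω - P κ n ω) ≤ M} :=
            measure_union_le _ _
        _ ≤ ε / 2 + ε / 2 := add_le_add ((hdev n hn0 M hM).trans hMε) hn
        _ = ε := ENNReal.add_halves ε
  -- underestimation
  have hlower : Tendsto (fun n => μ {ω | κn n ω ≤ κ - σ}) atTop (𝓝 0) := by
    by_cases hk : κ - σ ∈ Set.Icc a b
    swap
    · refine tendsto_const_nhds.congr' ?_
      filter_upwards [eventually_gt_atTop 0] with n hn
      symm
      rw [← nonpos_iff_eq_zero]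
      refine (measure_mono_ae ?_).trans (measure_empty (μ := μ)).le
      filter_upwards [hbasic n hn] with ω hω hle
      exact hk ⟨hω.1.1.trans hle, by linarith [hκ.2]⟩
    · set δ := m (κ - σ) - m κ with hδ
      have hδ0 : 0 < δ := sub_pos.mpr (hgap _ hk (by linarith))
      have hP0 := tendstoInMeasure_iff_dist.mp (hB1 κ hκ).2 (δ / 2) (by positivity)
      have hM0 : Tendsto (fun n : ℕ => ENNReal.ofReal (C / (δ / 2 * Real.sqrt n))) atTop
          (𝓝 0) := by
        have h1 : Tendsto (fun n : ℕ => δ / 2 * Real.sqrt n) atTop atTop :=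
          (Real.tendsto_sqrt_atTop.comp tendsto_natCast_atTop_atTop).const_mul_atTop
            (by positivity)
        have := ENNReal.tendsto_ofReal (tendsto_const_nhds (x := C).div_atTop h1)
        simpa using this
      have hsum := hM0.add hP0
      rw [add_zero] at hsum
      refine tendsto_of_tendsto_of_tendsto_of_le_of_le' tendsto_const_nhds hsum
        (Eventually.of_forall fun _ => zero_le) ?_
      filter_upwards [eventually_gt_atTop 0] with n hn0
      have hsn : 0 < Real.sqrt n := Real.sqrt_pos.mpr (by exact_mod_cast hn0)
      -- The gap `δ` is split evenly: the choice M = (δ/2)√n leaves δ/2 for the deviation, and hence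
      -- at least δ/2 for the penalty at `κ`.
      calc μ {ω | κn n ω ≤ κ - σ}
          ≤ μ (Dev n (δ / 2 * Real.sqrt n) ∪ {ω | δ / 2 ≤ dist (P κ n ω) 0}) := by
            refine measure_mono_ae ?_
            filter_upwards [hbasic n hn0, hP_mono n hn0, (hB1 a ha).1 n hn0] with ω hω hωm hωp hle
            by_cases hD : ω ∈ Dev n (δ / 2 * Real.sqrt n)
            · exact Or.inl hD
            · refine Or.inr ?_
              have e1 := hω.2 _ hD
              rw [mul_div_assoc, div_self hsn.ne', mul_one] at e1
              have e2 := hmono _ hω.1 _ hk hle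
              -- Positivity holds almost surely for each fixed index only; positivity at `a` and
              -- monotonicity carry it to the random index.
              have e3 : P a n ω ≤ P (κn n ω) n ω := hωm.monotoneOn ha hω.1 hω.1.1
              change δ / 2 ≤ dist (P κ n ω) 0
              rw [Real.dist_eq, sub_zero]
              refine le_trans ?_ (le_abs_self _)
              linarith
        _ ≤ μ (Dev n (δ / 2 * Real.sqrt n)) + μ {ω | δ / 2 ≤ dist (P κ n ω) 0} :=
            measure_union_le _ _
        _ ≤ _ := add_le_add_left (hdev n hn0 _ (by positivity)) _
  have hsum := hupper.add hlower
  rw [add_zero] at hsum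
  refine tendsto_of_tendsto_of_tendsto_of_le_of_le tendsto_const_nhds hsum
    (fun _ => zero_le) fun n => ?_
  refine (measure_mono fun ω hω => ?_).trans (measure_union_le _ _)
  have hω' : σ ≤ dist (κn n ω) κ := hω
  rw [Real.dist_eq, le_abs] at hω'
  rcases hω' with h1 | h1
  · exact Or.inl (show κ + σ ≤ κn n ω by linarith)
  · exact Or.inr (show κn n ω ≤ κ - σ by linarith)
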